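/- Let $X\subseteq\mathbb{R}^n$ be a closed convex set with nonempty interior, possibly unbounded (for instance $X=\mathbb{R}^n$), and let $F:X\to\mathbb{R}^n$ be continuous and strongly monotone, i.e. there is $M>0$ with $(F(y)-F(x))^T(y-x)\ge M\|y-x\|^2$ for all $x,y\in X$. A point $x^*\in X$ solves $VI(F,X)$ if $F(x^*)^T(x-x^*)\ge 0$ for all $x\in X$. Let $C_j=\{x\in\mathbb{R}^n: A_jx\le b_j\}$ $(j=1,2,\dots)$ be bounded polyhedra, each having a point with $A_jx<b_j$, such that $C_j\subseteq C_{j+1}$ and the closure of $\bigcup_{j\ge1}C_j$ is $X$. Write $g_{C}(x)=\max_{y\in C}F(x)^T(x-y)$. Fix $\eta\in[0,1)$; an approximate analytic center of a system $Ax\le b$ is a point $x$ with slack $s=b-Ax\ge 0$ for which there is a vector $z$ with $A^Tz=0$ and $\|Zs-e\|\le\eta$, where $Z=\operatorname{diag}(z)$, $e=(1,\dots,1)^T$ and $\|\cdot\|$ is the Euclidean norm. Algorithm 5 is the following procedure. Step 1. Start with $j=1$, $k=0$ and the system $A_1x\le b_1$. Step 2. Let $x_j^k$ be any approximate analytic center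 of the current system. If $x_j^k$ solves $VI(F,X)$, the algorithm is allowed (but not obliged) to stop. If $g_{C_j}(x_j^k)<1/2^j$, then increase $j$ by one, set $k=0$, replace the system by $A_jx\le b_j$ with the new $j$, and repeat Step 2; otherwise go to Step 3. Step 3. Add the inequality $F(x_j^k)^Tx\le F(x_j^k)^Tx_j^k$ to the current system, increase $k$ by one, and return to Step 2. Theorem 6. $VI(F,X)$ has exactly one solution $x^*$. The approximate analytic centers required by Algorithm 5 always exist, and for every choice of them, either the algorithm stops after finitely many iterations at $x^*$, or it generates an infinite sequence $\{x_j^k\}$ and a subsequence of that sequence converges to $x^*$. -/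

import Mathlib

open Filter Topology

noncomputable section

/-- `x` solves the variational inequality `VI(F, X)`: `x ∈ X` and
`F(x)ᵀ (y - x) ≥ 0` for all `y ∈ X`. -/
def SolvesVI {n : ℕ} (F : EuclideanSpace ℝ (Fin n) → EuclideanSpace ℝ (Fin n))
    (X : Set (EuclideanSpace ℝ (Fin n))) (x : EuclideanSpace ℝ (Fin n)) : Prop :=
  x ∈ X ∧ ∀ y ∈ X, 0 ≤ inner ℝ (F x) (y - x)

/-- `F` is strongly monotone on `X`:
`(F(y) - F(x))ᵀ (y - x) ≥ M ‖y - x‖ ^ 2` on `X`, with a constant `M > 0`. -/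
def StronglyMonotoneOn {n : ℕ} (F : EuclideanSpace ℝ (Fin n) → EuclideanSpace ℝ (Fin n))
    (X : Set (EuclideanSpace ℝ (Fin n))) : Prop :=
  ∃ M : ℝ, 0 < M ∧ ∀ x ∈ X, ∀ y ∈ X, M * ‖y - x‖ ^ 2 ≤ inner ℝ (F y - F x) (y - x)

/-- The gap function `g_C(x) = max_{y ∈ C} F(x)ᵀ (x - y)`. It is only used for nonempty compact
sets `C`, for which the supremum is a maximum. -/
def gap {n : ℕ} (F : EuclideanSpace ℝ (Fin n) → EuclideanSpace ℝ (Fin n))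
    (C : Set (EuclideanSpace ℝ (Fin n))) (x : EuclideanSpace ℝ (Fin n)) : ℝ :=
  sSup ((fun y => inner ℝ (F x) (x - y)) '' C)

/-- A finite system of linear inequalities `⟨aᵢ, x⟩ ≤ bᵢ` in `ℝⁿ`: the `aᵢ` are the rows of the
constraint matrix. -/
structure LinSystem (n : ℕ) where
  /-- the number of inequalities -/
  m : ℕ
  /-- the rows of the constraint matrix -/
  a : Fin m → EuclideanSpace ℝ (Fin n)
  /-- the right-hand sides -/
  b : Fin m → ℝ

namespace LinSystem

variable {n : ℕ}

/-- The polyhedron `{x | ∀ i, ⟨aᵢ, x⟩ ≤ bᵢ}`. -/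
def polyhedron (S : LinSystem n) : Set (EuclideanSpace ℝ (Fin n)) :=
  {x | ∀ i, inner ℝ (S.a i) x ≤ S.b i}

/-- The `i`-th slack `sᵢ = bᵢ - ⟨aᵢ, x⟩` at `x`. -/
def slack (S : LinSystem n) (x : EuclideanSpace ℝ (Fin n)) (i : Fin S.m) : ℝ :=
  S.b i - inner ℝ (S.a i) x

/-- The system describes a full-dimensional polytope: its polyhedron is bounded, and some point
satisfies all inequalities strictly. (If no row vanishes, the latter says exactly that the
polyhedron has nonempty interior.) -/
structure IsFullPolytope (S : LinSystem n) : Prop where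
  bounded : Bornology.IsBounded S.polyhedron
  strict : ∃ x, ∀ i, inner ℝ (S.a i) x < S.b i

/-- `x` is an approximate analytic center, with precision `η`, of the system: the slack vector `s`
at `x` is nonnegative, and there is a dual vector `z` with `∑ zᵢ aᵢ = 0` and
`‖Z s - e‖ ≤ η` in the Euclidean norm, where `Z = diag z` and `e` is the vector of all ones.
(For `η < 1` this forces `s > 0` and `z > 0`; for `η = 0` it is the exact analytic center.) -/
def IsApproxCenter (η : ℝ) (S : LinSystem n) (x : EuclideanSpace ℝ (Fin n)) : Prop :=
  (∀ i, 0 ≤ S.slack x i) ∧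
  ∃ z : Fin S.m → ℝ, ∑ i, z i • S.a i = 0 ∧ √(∑ i, (z i * S.slack x i - 1) ^ 2) ≤ η

/-- The system with one more inequality `⟨c, x⟩ ≤ β` at the end. -/
def addCut (S : LinSystem n) (c : EuclideanSpace ℝ (Fin n)) (β : ℝ) : LinSystem n where
  m := S.m + 1
  a := Fin.snoc (α := fun _ => EuclideanSpace ℝ (Fin n)) S.a c
  b := Fin.snoc (α := fun _ => ℝ) S.b β

end LinSystem

/-- A state of the cutting plane algorithm: the counters `j` and `k`, the system describing the
current polytope `C_j^k`, and the iterate `x_j^k`. -/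
structure CutState (n : ℕ) where
  j : ℕ
  k : ℕ
  sys : LinSystem n
  x : EuclideanSpace ℝ (Fin n)

/-- The initial states: `j = 1`, `k = 0`, the system is the one that describes `C_1`, and the
iterate is an approximate analytic center of it. -/
def IsInitialState {n : ℕ} (S : ℕ → LinSystem n) (η : ℝ) (s : CutState n) : Prop :=
  s.j = 1 ∧ s.k = 0 ∧ s.sys = S 1 ∧ s.sys.IsApproxCenter η s.x

/-- One iteration of the algorithm, from `s` to `s'`, where `C_j` is the polytope of `S j`.
If `g_{C_j}(x_j^k) < 1 / 2 ^ j`, then `j` is increased by one and the system is reset to that of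
the next polytope, with `k = 0`. Otherwise the cut `F(x_j^k)ᵀ (x - x_j^k) ≤ 0` is added to the
system and `k` is increased by one. In both cases the new iterate is an approximate analytic
center of the new system. -/
def CutStep {n : ℕ} (F : EuclideanSpace ℝ (Fin n) → EuclideanSpace ℝ (Fin n))
    (S : ℕ → LinSystem n) (η : ℝ) (s s' : CutState n) : Prop :=
  ((gap F (S s.j).polyhedron s.x < 1 / 2 ^ s.j ∧
      s'.j = s.j + 1 ∧ s'.k = 0 ∧ s'.sys = S (s.j + 1)) ∨
    (¬ gap F (S s.j).polyhedron s.x < 1 / 2 ^ s.j ∧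
      s'.j = s.j ∧ s'.k = s.k + 1 ∧ s'.sys = s.sys.addCut (F s.x) (inner ℝ (F s.x) s.x))) ∧
  s'.sys.IsApproxCenter η s'.x

/-- `σ` is a complete run of the algorithm on `VI(F, X)` with `N` states, `1 ≤ N ≤ ∞`; only the
values `σ t` with `t < N` matter. A run may end only at a state whose iterate solves `VI(F, X)`
(there it is allowed to stop, but not forced to) or at one from which no further iteration is
possible. -/
structure IsCompleteRun {n : ℕ} (F : EuclideanSpace ℝ (Fin n) → EuclideanSpace ℝ (Fin n))
    (X : Set (EuclideanSpace ℝ (Fin n))) (S : ℕ → LinSystem n) (η : ℝ)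
    (N : ℕ∞) (σ : ℕ → CutState n) : Prop where
  pos : 1 ≤ N
  init : IsInitialState S η (σ 0)
  step : ∀ t : ℕ, ((t + 1 : ℕ) : ℕ∞) < N → CutStep F S η (σ t) (σ (t + 1))
  complete : ∀ T : ℕ, N = ((T + 1 : ℕ) : ℕ∞) →
    SolvesVI F X (σ T).x ∨ ¬ ∃ s', CutStep F S η (σ T) s'

end

/-! Minty's lemma solves the variational inequality of a continuous monotone map on a compact convex
set. Strong monotonicity adds coercivity, which handles unbounded `X`, and uniqueness. Convergence
then has two halves.

Inner half: at a fixed `j` only finitely many cuts occur. A gap that stays at least `1 / 2 ^ j`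
keeps the iterates at distance `ρ` from a solution `u` on `C_j`, so strong monotonicity gives every
cut slack at least `M * ρ ^ 2` at `u`. Moving `u` slightly towards a strictly feasible point yields
`p` with all slacks above some `ε > 0` forever. `not_forall_le_slack_of_cuts` excludes this by
following the barrier value `∑ log sᵢ` at the centers. Near-optimality of the centers
(`logSlack_le`) bounds it below by `m log ε` up to a constant, with `m` the number of inequalities.
Yet each late cut adds at most `log ε - 1`: bounded cut normals eventually become small relative to
the quadratic form built up by earlier rows (`eventually_inner_sq_le_sum`), so the next center has
little slack in the new cut unless it moves far, which costs barrier value.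

Outer half: hence `j` tends to infinity, and the iterates at which `j` increases have gap tending to
0 over sets exhausting `X` up to closure. Strong monotonicity forces these iterates to `xstar`
(`SolvesVI.tendsto_of_gap_lt`). -/

noncomputable section

/-! ### Existence and uniqueness for monotone variational inequalities -/

/-- Finite intersection property behind Minty's lemma: a monotone map on a convex compact set
admits a common solution of finitely many of the dual inequalities. -/
theorem exists_forall_mem_finset_inner_nonneg {n : ℕ}
    {F : EuclideanSpace ℝ (Fin n) → EuclideanSpace ℝ (Fin n)}
    {K : Set (EuclideanSpace ℝ (Fin n))} (hconv : Convex ℝ K) (hcomp : IsCompact K)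
    (hne : K.Nonempty) (hmono : ∀ x ∈ K, ∀ y ∈ K, 0 ≤ inner ℝ (F y - F x) (y - x))
    (t : Finset K) : ∃ x ∈ K, ∀ y ∈ t, 0 ≤ inner ℝ (F y) ((y : EuclideanSpace ℝ (Fin n)) - x) := by
  classical
  by_contra! hcon
  let G : EuclideanSpace ℝ (Fin n) → (t → ℝ) :=
    fun x i => inner ℝ (F i.1) ((i.1 : EuclideanSpace ℝ (Fin n)) - x)
  have hGcont : Continuous G := by fun_prop
  have himg : Convex ℝ (G '' K) := by
    rintro _ ⟨x, hx, rfl⟩ _ ⟨y, hy, rfl⟩ a b ha hb hab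
    refine ⟨a • x + b • y, hconv hx hy ha hb hab, ?_⟩
    funext i
    simp only [G, Pi.add_apply, Pi.smul_apply, smul_eq_mul, inner_sub_right, inner_add_right,
      inner_smul_right]
    linear_combination -(inner ℝ (F i.1) (i.1 : EuclideanSpace ℝ (Fin n))) * hab
  have hdisj : Disjoint (G '' K) (Set.Ici (0 : t → ℝ)) := by
    rw [Set.disjoint_left]
    rintro _ ⟨x, hx, rfl⟩ h0
    obtain ⟨y, hy, hlt⟩ := hcon x hx
    exact absurd (h0 ⟨y, hy⟩) (not_le.mpr hlt)
  obtain ⟨f, u, v, hfu, huv, hvf⟩ := geometric_hahn_banach_compact_closed himg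
    (hcomp.image hGcont) (convex_Ici (𝕜 := ℝ) (0 : t → ℝ)) isClosed_Ici hdisj
  have hv0 : v < 0 := by simpa using hvf 0 (Set.mem_Ici.mpr le_rfl)
  let w : t → ℝ := fun i => f (Pi.single i 1)
  have hf : ∀ g : t → ℝ, f g = ∑ i, g i * w i := by
    intro g
    conv_lhs => rw [← Finset.univ_sum_single g]
    rw [map_sum]
    refine Finset.sum_congr rfl fun i _ => ?_
    have : (Pi.single i (g i) : t → ℝ) = g i • Pi.single i 1 := by
      rw [← Pi.single_smul]; simp
    rw [this, map_smul, smul_eq_mul]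
  -- A functional bounded below on the orthant, a cone, has nonnegative coefficients: with `w i < 0`
  -- the multiple `v / w i` of the basis vector would reach the value `v` itself.
  have hw : ∀ i, 0 ≤ w i := by
    intro i
    by_contra! hneg
    have h1 := hvf ((v / w i) • Pi.single i 1) (by
      have : 0 ≤ v / w i := (div_pos_of_neg_of_neg hv0 hneg).le
      have h1 : (0 : t → ℝ) ≤ Pi.single i 1 := Pi.single_nonneg.mpr zero_le_one
      exact smul_nonneg this h1)
    rw [map_smul, smul_eq_mul, div_mul_cancel₀ _ hneg.ne] at h1
    exact lt_irrefl _ h1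
  have hneg : ∀ x ∈ K, ∑ i, G x i * w i < 0 := fun x hx => by
    rw [← hf]; exact ((hfu _ ⟨x, hx, rfl⟩).trans huv).trans hv0
  have hW : 0 < ∑ i, w i := by
    refine lt_of_le_of_ne (Finset.sum_nonneg fun i _ => hw i) fun h => ?_
    have hz := (Finset.sum_eq_zero_iff_of_nonneg fun i _ => hw i).1 h.symm
    obtain ⟨x, hx⟩ := hne
    have := hneg x hx
    rw [Finset.sum_eq_zero fun i hi => by rw [hz i hi, mul_zero]] at this
    exact lt_irrefl _ this
  -- At the weighted mean `x` of the points, `∑ wᵢ (yᵢ - x) = 0`. Monotonicity replaces `F yᵢ` by `F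
  -- x` at no gain, so the weighted sum is nonnegative, against `hneg`.
  let x := Finset.univ.centerMass w fun i : t => (i.1 : EuclideanSpace ℝ (Fin n))
  have hx : x ∈ K := hconv.centerMass_mem (fun i _ => hw i) hW fun i _ => i.1.2
  have hsum : ∑ i, w i • ((i.1 : EuclideanSpace ℝ (Fin n)) - x) = 0 := by
    simp only [smul_sub, Finset.sum_sub_distrib, ← Finset.sum_smul]
    simp only [x, Finset.centerMass, smul_smul]
    rw [mul_inv_cancel₀ hW.ne', one_smul, sub_self]
  have h0 : ∑ i, inner ℝ (F x) ((i.1 : EuclideanSpace ℝ (Fin n)) - x) * w i = 0 := by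
    have h := congrArg (fun z => inner ℝ (F x) z) hsum
    rw [inner_sum, inner_zero_right] at h
    rw [← h]
    exact Finset.sum_congr rfl fun i _ => by rw [inner_smul_right, mul_comm]
  refine absurd (hneg x hx) (not_lt.mpr ?_)
  rw [← h0]
  refine Finset.sum_le_sum fun i _ => mul_le_mul_of_nonneg_right ?_ (hw i)
  have := hmono x hx i.1 i.1.2
  rw [inner_sub_left] at this
  simp only [G]; linarith

/-- A continuous monotone map on a nonempty compact convex set has a solution of its variational
inequality. -/
theorem exists_solvesVI_of_isCompact {n : ℕ}
    {F : EuclideanSpace ℝ (Fin n) → EuclideanSpace ℝ (Fin n)}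
    {K : Set (EuclideanSpace ℝ (Fin n))} (hconv : Convex ℝ K) (hcomp : IsCompact K)
    (hne : K.Nonempty) (hcont : ContinuousOn F K)
    (hmono : ∀ x ∈ K, ∀ y ∈ K, 0 ≤ inner ℝ (F y - F x) (y - x)) :
    ∃ x, SolvesVI F K x := by
  have hminty : (K ∩ ⋂ y : K,
      {x | 0 ≤ inner ℝ (F y) ((y : EuclideanSpace ℝ (Fin n)) - x)}).Nonempty := by
    refine hcomp.inter_iInter_nonempty _ (fun y => ?_) fun t => ?_
    · exact isClosed_le continuous_const (by fun_prop)
    · obtain ⟨x, hx, h⟩ := exists_forall_mem_finset_inner_nonneg hconv hcomp hne hmono t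
      exact ⟨x, hx, by simpa using h⟩
  obtain ⟨x, hx, hdual⟩ := hminty
  simp only [Set.mem_iInter, Set.mem_ofPred_eq, Subtype.forall] at hdual
  refine ⟨x, hx, fun y hy => ?_⟩
  -- Minty's trick: apply the dual inequality at points of the segment towards `y`, divide by `s`,
  -- and let `s` tend to 0.
  have hmem : ∀ s ∈ Set.Icc (0 : ℝ) 1, x + s • (y - x) ∈ K := fun s hs =>
    hconv.add_smul_sub_mem hx hy hs
  have hlim : Tendsto (fun s : ℝ => inner ℝ (F (x + s • (y - x))) (y - x)) (𝓝[>] 0)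
      (𝓝 (inner ℝ (F x) (y - x))) := by
    refine Tendsto.inner ?_ tendsto_const_nhds
    refine (hcont x hx).tendsto.comp (tendsto_nhdsWithin_iff.2 ⟨?_, ?_⟩)
    · have : Continuous fun s : ℝ => x + s • (y - x) := by fun_prop
      simpa using (this.tendsto 0).mono_left nhdsWithin_le_nhds
    · filter_upwards [Ioc_mem_nhdsGT (zero_lt_one (α := ℝ))] with s hs
      exact hmem s ⟨hs.1.le, hs.2⟩
  refine ge_of_tendsto hlim ?_
  filter_upwards [Ioc_mem_nhdsGT (zero_lt_one (α := ℝ))] with s hs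
  have := hdual _ (hmem s ⟨hs.1.le, hs.2⟩)
  rw [add_sub_cancel_left, inner_smul_right] at this
  exact nonneg_of_mul_nonneg_right this hs.1

theorem StronglyMonotoneOn.mono {n : ℕ}
    {F : EuclideanSpace ℝ (Fin n) → EuclideanSpace ℝ (Fin n)}
    {X K : Set (EuclideanSpace ℝ (Fin n))} (h : StronglyMonotoneOn F X) (hK : K ⊆ X) :
    StronglyMonotoneOn F K := by
  obtain ⟨M, hM, h⟩ := h
  exact ⟨M, hM, fun x hx y hy => h x (hK hx) y (hK hy)⟩

theorem StronglyMonotoneOn.inner_nonneg {n : ℕ}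
    {F : EuclideanSpace ℝ (Fin n) → EuclideanSpace ℝ (Fin n)}
    {X : Set (EuclideanSpace ℝ (Fin n))} (h : StronglyMonotoneOn F X) :
    ∀ x ∈ X, ∀ y ∈ X, 0 ≤ inner ℝ (F y - F x) (y - x) := by
  obtain ⟨M, hM, h⟩ := h
  exact fun x hx y hy => le_trans (by positivity) (h x hx y hy)

theorem StronglyMonotoneOn.solvesVI_unique {n : ℕ}
    {F : EuclideanSpace ℝ (Fin n) → EuclideanSpace ℝ (Fin n)}
    {X : Set (EuclideanSpace ℝ (Fin n))} (h : StronglyMonotoneOn F X)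
    {x y : EuclideanSpace ℝ (Fin n)} (hx : SolvesVI F X x) (hy : SolvesVI F X y) : y = x := by
  obtain ⟨M, hM, h⟩ := h
  have h1 := h x hx.1 y hy.1
  have h2 := hx.2 y hy.1
  have h3 := hy.2 x hx.1
  rw [← neg_sub y x, inner_neg_right] at h3
  rw [inner_sub_left] at h1
  have h4 : ‖y - x‖ ^ 2 ≤ 0 := by
    by_contra! hpos
    linarith [mul_pos hM hpos]
  have : ‖y - x‖ = 0 := by
    have := sq_nonneg ‖y - x‖
    exact pow_eq_zero_iff two_ne_zero |>.1 (le_antisymm h4 this)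
  exact sub_eq_zero.1 (norm_eq_zero.1 this)

/-- A continuous strongly monotone map on a nonempty closed convex set has a solution of its
variational inequality. -/
theorem StronglyMonotoneOn.exists_solvesVI {n : ℕ}
    {F : EuclideanSpace ℝ (Fin n) → EuclideanSpace ℝ (Fin n)}
    {X : Set (EuclideanSpace ℝ (Fin n))} (h : StronglyMonotoneOn F X)
    (hconv : Convex ℝ X) (hclosed : IsClosed X) (hne : X.Nonempty) (hcont : ContinuousOn F X) :
    ∃ x, SolvesVI F X x := by
  obtain ⟨x₀, hx₀⟩ := hne
  obtain ⟨M, hM, hF⟩ := id h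
  -- A solution on the truncated set satisfies `M * ‖x - x₀‖ ≤ ‖F x₀‖`, so with this radius the ball
  -- constraint is inactive and the solution extends to `X`.
  set R : ℝ := ‖F x₀‖ / M + 1 with hR
  have hRpos : 0 < R := by positivity
  obtain ⟨x, ⟨hxX, hxR⟩, hx⟩ := exists_solvesVI_of_isCompact (F := F)
    (K := X ∩ Metric.closedBall x₀ R)
    (hconv.inter (convex_closedBall _ _)) ((isCompact_closedBall x₀ R).inter_left hclosed)
    ⟨x₀, hx₀, Metric.mem_closedBall_self hRpos.le⟩ (hcont.mono Set.inter_subset_left)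
    (h.mono Set.inter_subset_left).inner_nonneg
  have hlt : ‖x - x₀‖ < R := by
    have h1 := hx x₀ ⟨hx₀, Metric.mem_closedBall_self hRpos.le⟩
    have h2 := hF x₀ hx₀ x hxX
    rw [inner_sub_left] at h2
    rw [← neg_sub x x₀, inner_neg_right] at h1
    have h3 : -(‖F x₀‖ * ‖x - x₀‖) ≤ inner ℝ (F x₀) (x - x₀) :=
      (abs_le.1 (abs_real_inner_le_norm (F x₀) (x - x₀))).1
    have h4 : M * ‖x - x₀‖ ^ 2 ≤ ‖F x₀‖ * ‖x - x₀‖ := by linarith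
    by_contra! hge
    have hp : 0 < ‖x - x₀‖ := hRpos.trans_le hge
    have h5 : M * ‖x - x₀‖ ≤ ‖F x₀‖ := by
      refine le_of_mul_le_mul_right ?_ hp
      linarith [h4, sq ‖x - x₀‖, mul_assoc M ‖x - x₀‖ ‖x - x₀‖]
    have h6 : M * R = ‖F x₀‖ + M := by rw [hR]; field_simp
    nlinarith [mul_le_mul_of_nonneg_left hge hM.le]
  refine ⟨x, hxX, fun y hy => ?_⟩
  have hev : ∀ᶠ s : ℝ in 𝓝[>] 0, x + s • (y - x) ∈ Metric.closedBall x₀ R := by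
    have hc : Continuous fun s : ℝ => x + s • (y - x) := by fun_prop
    refine nhdsWithin_le_nhds (hc.continuousAt.eventually_mem ?_)
    simp only [zero_smul, add_zero]
    exact Metric.closedBall_mem_nhds_of_mem (by rwa [Metric.mem_ball, dist_eq_norm])
  obtain ⟨s, hs1, hs2⟩ := (hev.and (Ioc_mem_nhdsGT (zero_lt_one (α := ℝ)))).exists
  have := hx _ ⟨hconv.add_smul_sub_mem hxX hy ⟨hs2.1.le, hs2.2⟩, hs1⟩
  rw [add_sub_cancel_left, inner_smul_right] at this
  exact nonneg_of_mul_nonneg_right this hs2.1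

/-! ### Scalar inequalities for the logarithm -/

/-- In the variable `w = a ^ 2` the function `a - log (1 + a)` has the decreasing derivative `1 / (2
(1 + √w))`. Concavity together with the value 0 at 0 puts it above its chords from 0. -/
theorem Real.concaveOn_sqrt_sub_log_one_add_sqrt :
    ConcaveOn ℝ (Set.Ici 0) fun w : ℝ => √w - Real.log (1 + √w) := by
  have hpos : ∀ w : ℝ, 0 < 1 + √w := fun w => by positivity
  have hd : ∀ w ∈ Set.Ioi (0 : ℝ),
      HasDerivAt (fun w : ℝ => √w - Real.log (1 + √w)) (1 / (2 * (1 + √w))) w := by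
    intro w hw
    have hs : 0 < √w := Real.sqrt_pos.2 hw
    have h1 := Real.hasDerivAt_sqrt (ne_of_gt hw)
    have h2 := h1.sub ((h1.const_add 1).log (hpos w).ne')
    refine h2.congr_deriv ?_
    field_simp
    ring
  refine AntitoneOn.concaveOn_of_deriv (convex_Ici 0) ?_ ?_ ?_
  · refine Continuous.continuousOn ?_
    exact Real.continuous_sqrt.sub
      ((continuous_const.add Real.continuous_sqrt).log fun w => (hpos w).ne')
  · rw [interior_Ici]
    exact fun w hw => (hd w hw).differentiableAt.differentiableWithinAt
  · rw [interior_Ici]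
    intro w hw w' hw' hle
    rw [(hd w hw).deriv, (hd w' hw').deriv]
    have := Real.sqrt_le_sqrt hle
    have := hpos w
    gcongr

/-- `u - log (1 + u)` dominates the multiple of `u ^ 2` that agrees with it at the right end of
`(-1, t]`. -/
theorem Real.log_one_add_le_sub_sq_mul {u t : ℝ} (ht : 0 < t) (hu : -1 < u) (hut : |u| ≤ t) :
    Real.log (1 + u) ≤ u - u ^ 2 / t ^ 2 * (t - Real.log (1 + t)) := by
  have key : ∀ a : ℝ, 0 ≤ a → a ≤ t →
      a ^ 2 / t ^ 2 * (t - Real.log (1 + t)) ≤ a - Real.log (1 + a) := by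
    intro a ha hat
    have hr : a ^ 2 / t ^ 2 ≤ 1 := by
      rw [div_le_one (by positivity)]
      gcongr
    have h := Real.concaveOn_sqrt_sub_log_one_add_sqrt.2
      (Set.mem_Ici.2 (le_refl (0 : ℝ))) (Set.mem_Ici.2 (sq_nonneg t))
      (sub_nonneg.2 hr) (by positivity) (sub_add_cancel 1 (a ^ 2 / t ^ 2))
    have he : a ^ 2 / t ^ 2 * t ^ 2 = a ^ 2 := by field_simp
    simpa [he, Real.sqrt_sq ht.le, Real.sqrt_sq ha] using h
  rcases le_or_gt 0 u with h0 | h0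
  · have := key u h0 ((le_abs_self u).trans hut)
    linarith
  · rw [abs_of_neg h0] at hut
    have h1 := key (-u) (by linarith) hut
    rw [neg_sq] at h1
    -- `log (1 + u) - log (1 - u) ≤ 2 u` for `u ≤ 0`
    have hanti : ∀ a ∈ Set.Ico (0 : ℝ) 1, 2 * a + Real.log (1 - a) - Real.log (1 + a) ≤ 0 := by
      have hd : ∀ a ∈ Set.Ico (0 : ℝ) 1,
          HasDerivAt (fun a : ℝ => 2 * a + Real.log (1 - a) - Real.log (1 + a))
            (2 + (-1) / (1 - a) - 1 / (1 + a)) a := by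
        intro a ha
        have h1 : (1 : ℝ) - a ≠ 0 := by linarith [ha.2]
        have h2 : (1 : ℝ) + a ≠ 0 := by linarith [ha.1]
        have e1 := ((hasDerivAt_id a).const_sub 1).log h1
        have e2 := ((hasDerivAt_id a).const_add 1).log h2
        have e3 := (hasDerivAt_id a).const_mul 2
        refine ((e3.add e1).sub e2).congr_deriv ?_
        simp
      have hmono : AntitoneOn (fun a : ℝ => 2 * a + Real.log (1 - a) - Real.log (1 + a))
          (Set.Ico (0 : ℝ) 1) := by
        refine antitoneOn_of_deriv_nonpos (convex_Ico 0 1)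
          (fun a ha => (hd a ha).continuousAt.continuousWithinAt) ?_ ?_
        · rw [interior_Ico]
          exact fun a ha =>
            (hd a ⟨ha.1.le, ha.2⟩).differentiableAt.differentiableWithinAt
        · rw [interior_Ico]
          intro a ha
          rw [(hd a ⟨ha.1.le, ha.2⟩).deriv]
          have h1 : (0 : ℝ) < 1 - a := by linarith [ha.2]
          have h2 : (0 : ℝ) < 1 + a := by linarith [ha.1]
          have : 2 + (-1) / (1 - a) - 1 / (1 + a) = -(2 * a ^ 2) / ((1 - a) * (1 + a)) := by
            field_simp; ring
          rw [this]
          exact div_nonpos_of_nonpos_of_nonneg (by nlinarith [sq_nonneg a]) (by positivity)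
      intro a ha
      have := hmono ⟨le_rfl, zero_lt_one⟩ ha ha.1
      simpa using this
    have h2 := hanti (-u) ⟨by linarith, by linarith⟩
    rw [sub_neg_eq_add, ← sub_eq_add_neg] at h2
    rw [← sub_eq_add_neg] at h1
    linarith

/-! ### Domination of bounded vectors by accumulated quadratic forms -/

/-- If `|⟨c_k, v⟩|² ≤ δ² (Q v + ∑_{l < k} ⟨c_l, v⟩²)` failed for infinitely many `k`, a limit of
the offending directions would be orthogonal to a limit of the `c_k`, hence a zero of `Q`. -/
theorem eventually_inner_sq_le_sum {E : Type*} [NormedAddCommGroup E] [InnerProductSpace ℝ E]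
    [FiniteDimensional ℝ E] {Q : E → ℝ} (hQcont : Continuous Q)
    (hQsmul : ∀ (r : ℝ) v, Q (r • v) = r ^ 2 * Q v) (hQpos : ∀ v, v ≠ 0 → 0 < Q v)
    {c : ℕ → E} {R : ℝ} (hc : ∀ k, ‖c k‖ ≤ R) {δ : ℝ} (hδ : 0 < δ) :
    ∀ᶠ k in atTop, ∀ v, inner ℝ (c k) v ^ 2 ≤
      δ * (Q v + ∑ l ∈ Finset.range k, inner ℝ (c l) v ^ 2) := by
  by_contra hnot
  rw [not_eventually] at hnot
  have hunit : ∃ᶠ k in atTop, ∃ v, v ∈ Metric.sphere (0 : E) 1 ∧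
      δ * (Q v + ∑ l ∈ Finset.range k, inner ℝ (c l) v ^ 2) ≤ inner ℝ (c k) v ^ 2 := by
    refine hnot.mono fun k hk => ?_
    push Not at hk
    obtain ⟨v, hv⟩ := hk
    have hv0 : v ≠ 0 := by
      rintro rfl
      have : Q 0 = 0 := by simpa using hQsmul 0 0
      simp [this] at hv
    have hn : ‖v‖ ≠ 0 := norm_ne_zero_iff.2 hv0
    refine ⟨‖v‖⁻¹ • v, by simp [norm_smul, hn], ?_⟩
    simp only [hQsmul, inner_smul_right, mul_pow, ← Finset.mul_sum, ← mul_add]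
    rw [mul_left_comm]
    gcongr
  obtain ⟨k, hkmono, hk⟩ := extraction_of_frequently_atTop hunit
  choose v hv hvk using hk
  have hcpt : IsCompact (Metric.sphere (0 : E) 1 ×ˢ Metric.closedBall (0 : E) R) :=
    (isCompact_sphere _ _).prod (isCompact_closedBall _ _)
  obtain ⟨⟨w, d⟩, hwd, ψ, hψ, hlim⟩ := hcpt.tendsto_subseq (x := fun i => (v i, c (k i)))
    fun i => ⟨hv i, by simpa using hc (k i)⟩
  have hlv : Tendsto (fun i => v (ψ i)) atTop (𝓝 w) := (continuous_fst.tendsto _).comp hlim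
  have hlc : Tendsto (fun i => c (k (ψ i))) atTop (𝓝 d) := (continuous_snd.tendsto _).comp hlim
  have hkψ : StrictMono fun i => k (ψ i) := hkmono.comp hψ
  have hw0 : w ≠ 0 := by
    rintro rfl
    simpa using hwd.1
  have hinner : Tendsto (fun i => inner ℝ (c (k (ψ i))) (v (ψ i)) ^ 2) atTop
      (𝓝 (inner ℝ d w ^ 2)) := (hlc.inner hlv).pow 2
  -- The number `m` of summands is frozen before passing to the limit. The resulting bound is
  -- uniform in `m`, so the series at `w` converges, its terms vanish along the subsequence, and
  -- `⟨d, w⟩ = 0`.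
  have hpart : ∀ m, δ * (Q w + ∑ l ∈ Finset.range m, inner ℝ (c l) w ^ 2) ≤ inner ℝ d w ^ 2 := by
    intro m
    have hcontm : Continuous fun u : E =>
        δ * (Q u + ∑ l ∈ Finset.range m, inner ℝ (c l) u ^ 2) := by fun_prop
    refine le_of_tendsto_of_tendsto ((hcontm.tendsto w).comp hlv) hinner ?_
    filter_upwards [eventually_ge_atTop m] with i hi
    refine le_trans ?_ (hvk (ψ i))
    refine mul_le_mul_of_nonneg_left ?_ hδ.le
    gcongr
    exact hi.trans (hkψ.id_le i)
  have hsummable : Summable fun l => inner ℝ (c l) w ^ 2 := by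
    refine summable_of_sum_range_le (c := inner ℝ d w ^ 2 / δ) (fun l => sq_nonneg _) fun m => ?_
    rw [le_div_iff₀ hδ]
    nlinarith [hpart m, hQpos w hw0]
  have hzero : Tendsto (fun i => inner ℝ (c (k (ψ i))) w ^ 2) atTop (𝓝 0) :=
    hsummable.tendsto_atTop_zero.comp hkψ.tendsto_atTop
  have hdw : inner ℝ d w ^ 2 = 0 :=
    tendsto_nhds_unique ((hlc.inner tendsto_const_nhds).pow 2) hzero
  have := hpart 0
  rw [hdw] at this
  simp only [Finset.range_zero, Finset.sum_empty, add_zero] at this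
  linarith [mul_pos hδ (hQpos w hw0)]

/-! ### Logarithmic barrier and approximate analytic centers -/

namespace LinSystem

variable {n : ℕ}

theorem slack_eq_sub (S : LinSystem n) (x y : EuclideanSpace ℝ (Fin n)) (i : Fin S.m) :
    S.slack y i = S.slack x i - inner ℝ (S.a i) (y - x) := by
  simp only [slack, inner_sub_right]; ring

theorem mem_polyhedron_iff_slack (S : LinSystem n) (x : EuclideanSpace ℝ (Fin n)) :
    x ∈ S.polyhedron ↔ ∀ i, 0 ≤ S.slack x i := by
  simp [polyhedron, slack]

theorem isClosed_polyhedron (S : LinSystem n) : IsClosed S.polyhedron := by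
  have : S.polyhedron = ⋂ i, {x | inner ℝ (S.a i) x ≤ S.b i} := by
    ext x; simp [polyhedron]
  rw [this]
  exact isClosed_iInter fun i => isClosed_le (by fun_prop) continuous_const

theorem convex_polyhedron (S : LinSystem n) : Convex ℝ S.polyhedron := by
  intro x hx y hy a b ha hb hab i
  rw [inner_add_right, inner_smul_right, inner_smul_right]
  calc a * inner ℝ (S.a i) x + b * inner ℝ (S.a i) y ≤ a * S.b i + b * S.b i := by
        gcongr
        exacts [hx i, hy i]
    _ = S.b i := by rw [← add_mul, hab, one_mul]

theorem continuous_slack (S : LinSystem n) (i : Fin S.m) : Continuous fun x => S.slack x i := by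
  unfold slack; fun_prop

theorem forall_addCut (S : LinSystem n) (c : EuclideanSpace ℝ (Fin n)) (β : ℝ)
    (P : EuclideanSpace ℝ (Fin n) → ℝ → Prop) :
    (∀ i, P ((S.addCut c β).a i) ((S.addCut c β).b i)) ↔ (∀ i, P (S.a i) (S.b i)) ∧ P c β := by
  refine (Fin.forall_fin_succ' (n := S.m)).trans ?_
  simp [addCut]

theorem sum_addCut (S : LinSystem n) (c : EuclideanSpace ℝ (Fin n)) (β : ℝ)
    (f : EuclideanSpace ℝ (Fin n) → ℝ → ℝ) :
    ∑ i, f ((S.addCut c β).a i) ((S.addCut c β).b i) = ∑ i, f (S.a i) (S.b i) + f c β := by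
  refine (Fin.sum_univ_castSucc (n := S.m) _).trans ?_
  simp [addCut]

theorem mem_polyhedron_addCut (S : LinSystem n) (c : EuclideanSpace ℝ (Fin n)) (β : ℝ)
    (x : EuclideanSpace ℝ (Fin n)) :
    x ∈ (S.addCut c β).polyhedron ↔ x ∈ S.polyhedron ∧ inner ℝ c x ≤ β :=
  S.forall_addCut c β fun a b => inner ℝ a x ≤ b

/-- The logarithmic barrier `∑ log sᵢ`. -/
def logSlack (S : LinSystem n) (x : EuclideanSpace ℝ (Fin n)) : ℝ :=
  ∑ i, Real.log (S.slack x i)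

/-- The norm of `v` with respect to the Hessian at `x` of the logarithmic barrier. -/
def localNorm (S : LinSystem n) (x v : EuclideanSpace ℝ (Fin n)) : ℝ :=
  √(∑ i, (inner ℝ (S.a i) v / S.slack x i) ^ 2)

theorem localNorm_nonneg (S : LinSystem n) (x v : EuclideanSpace ℝ (Fin n)) :
    0 ≤ S.localNorm x v := Real.sqrt_nonneg _

theorem logSlack_addCut (S : LinSystem n) (c x : EuclideanSpace ℝ (Fin n)) (β : ℝ) :
    (S.addCut c β).logSlack x = S.logSlack x + Real.log (β - inner ℝ c x) :=
  S.sum_addCut c β fun a b => Real.log (b - inner ℝ a x)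

variable {S : LinSystem n} {η : ℝ} {x : EuclideanSpace ℝ (Fin n)}

theorem IsApproxCenter.mem_polyhedron (h : S.IsApproxCenter η x) : x ∈ S.polyhedron :=
  (S.mem_polyhedron_iff_slack x).2 h.1

theorem IsApproxCenter.slack_pos (h : S.IsApproxCenter η x) (hη₁ : η < 1) (i : Fin S.m) :
    0 < S.slack x i := by
  obtain ⟨h0, z, -, hz⟩ := h
  refine lt_of_le_of_ne (h0 i) fun hi => ?_
  have h1 : (1 : ℝ) ≤ ∑ i, (z i * S.slack x i - 1) ^ 2 := by
    calc (1 : ℝ) = (z i * S.slack x i - 1) ^ 2 := by rw [← hi]; ring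
      _ ≤ _ := Finset.single_le_sum (f := fun i => (z i * S.slack x i - 1) ^ 2)
          (fun i _ => sq_nonneg _) (Finset.mem_univ i)
  linarith [Real.one_le_sqrt.2 h1]

/-- Near-optimality of an approximate analytic center for the logarithmic barrier. -/
theorem IsApproxCenter.logSlack_le (h : S.IsApproxCenter η x) (hη₁ : η < 1)
    {y : EuclideanSpace ℝ (Fin n)} (hy : ∀ i, 0 < S.slack y i) :
    S.logSlack y ≤ S.logSlack x - (1 - η) * S.localNorm x (y - x) +
      Real.log (1 + S.localNorm x (y - x)) := by
  have hx := h.slack_pos hη₁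
  obtain ⟨-, z, hz0, hz⟩ := h
  set t := S.localNorm x (y - x) with ht
  let u : Fin S.m → ℝ := fun i => -(inner ℝ (S.a i) (y - x) / S.slack x i)
  have hu : ∀ i, 1 + u i = S.slack y i / S.slack x i := fun i => by
    have := (hx i).ne'
    rw [S.slack_eq_sub x y]
    simp only [u]; field_simp; ring
  have hupos : ∀ i, 0 < 1 + u i := fun i => by rw [hu]; exact div_pos (hy i) (hx i)
  have hut : ∑ i, u i ^ 2 = t ^ 2 := by
    rw [ht, localNorm, Real.sq_sqrt (Finset.sum_nonneg fun i _ => sq_nonneg _)]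
    simp only [u, neg_sq]
  have ht0 : 0 ≤ t := S.localNorm_nonneg _ _
  have hule : ∀ i, |u i| ≤ t := fun i => by
    refine abs_le_of_sq_le_sq ?_ ht0
    rw [← hut]
    exact Finset.single_le_sum (f := fun i => u i ^ 2) (fun i _ => sq_nonneg _) (Finset.mem_univ i)
  have hdiff : S.logSlack y = S.logSlack x + ∑ i, Real.log (1 + u i) := by
    simp only [logSlack]
    rw [← Finset.sum_add_distrib]
    refine Finset.sum_congr rfl fun i _ => ?_
    rw [hu, Real.log_div (hy i).ne' (hx i).ne']; ring
  have hzu : ∑ i, z i * S.slack x i * u i = 0 := by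
    have h1 : inner ℝ (∑ i, z i • S.a i) (y - x) = 0 := by rw [hz0, inner_zero_left]
    rw [sum_inner] at h1
    rw [← neg_eq_zero, ← h1, ← Finset.sum_neg_distrib]
    refine Finset.sum_congr rfl fun i _ => ?_
    have := (hx i).ne'
    rw [real_inner_smul_left]
    simp only [u]; field_simp
  -- Since `Aᵀ z = 0`, the first-order term is tested only against `Z s - e`; Cauchy–Schwarz then
  -- brings in the precision `η`.
  have hsum : ∑ i, u i ≤ η * t := by
    have h1 : ∑ i, u i = ∑ i, (z i * S.slack x i - 1) * (-u i) := by
      have : ∑ i, (z i * S.slack x i - 1) * (-u i) = ∑ i, u i - ∑ i, z i * S.slack x i * u i := by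
        rw [← Finset.sum_sub_distrib]
        exact Finset.sum_congr rfl fun i _ => by ring
      rw [this, hzu, sub_zero]
    rw [h1]
    refine (Real.sum_mul_le_sqrt_mul_sqrt _ _ _).trans ?_
    simp only [neg_sq]
    rw [hut, Real.sqrt_sq ht0]
    gcongr
  rw [hdiff]
  rcases ht0.eq_or_lt with h0 | hpos
  · have hu0 : ∀ i, u i = 0 := fun i => by
      have := hule i
      rw [← h0] at this
      exact abs_nonpos_iff.1 this
    simp [hu0, ← h0]
  · have h1 : ∑ i, Real.log (1 + u i) ≤
        ∑ i, (u i - u i ^ 2 / t ^ 2 * (t - Real.log (1 + t))) :=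
      Finset.sum_le_sum fun i _ =>
        Real.log_one_add_le_sub_sq_mul hpos (by linarith [hupos i]) (hule i)
    rw [Finset.sum_sub_distrib, ← Finset.sum_mul, ← Finset.sum_div, hut,
      div_self (by positivity), one_mul] at h1
    linarith

/-- A full polytope has an exact analytic center: the maximizer of the product of the slacks. -/
theorem IsFullPolytope.exists_isApproxCenter (h : S.IsFullPolytope) (hη₀ : 0 ≤ η) :
    ∃ x, S.IsApproxCenter η x := by
  obtain ⟨q, hq⟩ := h.strict
  have hq' : ∀ i, 0 < S.slack q i := fun i => sub_pos.2 (hq i)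
  have hcpt : IsCompact S.polyhedron :=
    Metric.isCompact_of_isClosed_isBounded S.isClosed_polyhedron h.bounded
  obtain ⟨x, hx, hmax⟩ := hcpt.exists_isMaxOn
    ⟨q, (S.mem_polyhedron_iff_slack q).2 fun i => (hq' i).le⟩
    -- The product, unlike the sum of logarithms, is continuous up to the boundary, and its positive
    -- value at `q` keeps the maximizer strictly inside.
    (f := fun x => ∏ i, S.slack x i)
    (continuous_finsetProd _ fun i _ => S.continuous_slack i).continuousOn
  have hx0 := (S.mem_polyhedron_iff_slack x).1 hx
  have hprod : 0 < ∏ i, S.slack x i :=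
    (Finset.prod_pos fun i _ => hq' i).trans_le
      (hmax ((S.mem_polyhedron_iff_slack q).2 fun i => (hq' i).le))
  have hxpos : ∀ i, 0 < S.slack x i := fun i =>
    lt_of_le_of_ne (hx0 i) fun h0 => hprod.ne' (Finset.prod_eq_zero (Finset.mem_univ i) h0.symm)
  refine ⟨x, hx0, fun i => (S.slack x i)⁻¹, ?_, ?_⟩
  · have hdir : ∀ v, ∑ i, inner ℝ (S.a i) v / S.slack x i = 0 := by
      intro v
      have hline : ∀ (r : ℝ) i, S.slack (x + r • v) i = S.slack x i - r * inner ℝ (S.a i) v := by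
        intro r i
        rw [S.slack_eq_sub x, add_sub_cancel_left, inner_smul_right]
      have hd : HasDerivAt (fun r : ℝ => ∑ i, Real.log (S.slack x i - r * inner ℝ (S.a i) v))
          (∑ i, -(inner ℝ (S.a i) v) / S.slack x i) 0 := by
        refine HasDerivAt.fun_sum fun i _ => ?_
        have h1 := ((hasDerivAt_id (0 : ℝ)).mul_const (inner ℝ (S.a i) v)).const_sub (S.slack x i)
        have h2 := h1.log (by simpa using (hxpos i).ne')
        simpa using h2
      have hloc : IsLocalMax
          (fun r : ℝ => ∑ i, Real.log (S.slack x i - r * inner ℝ (S.a i) v)) 0 := by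
        have hev : ∀ᶠ r : ℝ in 𝓝 0, ∀ i, 0 < S.slack x i - r * inner ℝ (S.a i) v := by
          refine eventually_all.2 fun i => ?_
          have hc : Continuous fun r : ℝ => S.slack x i - r * inner ℝ (S.a i) v := by fun_prop
          exact hc.continuousAt.eventually_mem (Ioi_mem_nhds (by simpa using hxpos i))
        filter_upwards [hev] with r hr
        have hmem : x + r • v ∈ S.polyhedron :=
          (S.mem_polyhedron_iff_slack _).2 fun i => by rw [hline]; exact (hr i).le
        have hle : ∏ i, S.slack (x + r • v) i ≤ ∏ i, S.slack x i := hmax hmem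
        simp only [hline] at hle
        simp only [zero_mul, sub_zero]
        rw [← Real.log_prod fun i _ => (hr i).ne', ← Real.log_prod fun i _ => (hxpos i).ne']
        exact Real.log_le_log (Finset.prod_pos fun i _ => hr i) hle
      have h0 := hloc.hasDerivAt_eq_zero hd
      simpa [neg_div] using h0
    refine ext_inner_right ℝ fun v => ?_
    rw [sum_inner, inner_zero_left, ← hdir v]
    exact Finset.sum_congr rfl fun i _ => by rw [real_inner_smul_left, div_eq_inv_mul]
  · have : ∀ i, (S.slack x i)⁻¹ * S.slack x i - 1 = 0 := fun i => by
      rw [inv_mul_cancel₀ (hxpos i).ne', sub_self]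
    simpa [this] using hη₀

/-- The rows of a full polytope span the space. -/
theorem IsFullPolytope.sum_inner_sq_pos (h : S.IsFullPolytope) {v : EuclideanSpace ℝ (Fin n)}
    (hv : v ≠ 0) : 0 < ∑ i, inner ℝ (S.a i) v ^ 2 := by
  refine lt_of_le_of_ne (Finset.sum_nonneg fun i _ => sq_nonneg _) fun h0 => ?_
  have hz : ∀ i, inner ℝ (S.a i) v = 0 := fun i => by
    have := (Finset.sum_eq_zero_iff_of_nonneg fun i _ => sq_nonneg _).1 h0.symm i (Finset.mem_univ i)
    exact pow_eq_zero_iff two_ne_zero |>.1 this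
  obtain ⟨q, hq⟩ := h.strict
  obtain ⟨B, hB⟩ := h.bounded.exists_norm_le
  -- A direction orthogonal to all rows would put a whole line into the bounded polyhedron.
  have hmem : ∀ r : ℝ, q + r • v ∈ S.polyhedron := fun r i => by
    rw [inner_add_right, inner_smul_right, hz, mul_zero, add_zero]
    exact (hq i).le
  have hvn : 0 < ‖v‖ := norm_pos_iff.2 hv
  have hBq : 0 ≤ B := (norm_nonneg _).trans (hB _ (hmem 0))
  have h1 := hB _ (hmem ((B + ‖q‖ + 1) / ‖v‖))
  have h2 : ‖((B + ‖q‖ + 1) / ‖v‖) • v‖ = B + ‖q‖ + 1 := by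
    rw [norm_smul, Real.norm_of_nonneg (by positivity), div_mul_cancel₀ _ hvn.ne']
  have h3 := norm_sub_le (q + ((B + ‖q‖ + 1) / ‖v‖) • v) q
  rw [add_sub_cancel_left, h2] at h3
  linarith

/-- On a bounded set, the slacks of a system are bounded. -/
theorem exists_slack_le (S : LinSystem n) {K : Set (EuclideanSpace ℝ (Fin n))}
    (hK : Bornology.IsBounded K) : ∃ D, ∀ y ∈ K, ∀ i, S.slack y i ≤ D := by
  obtain ⟨B, hB⟩ := hK.exists_norm_le
  refine ⟨∑ i, (|S.b i| + ‖S.a i‖ * |B|), fun y hy i => ?_⟩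
  have h1 : S.slack y i ≤ |S.b i| + ‖S.a i‖ * |B| := by
    have h2 := (abs_le.1 (abs_real_inner_le_norm (S.a i) y)).1
    have h3 : ‖S.a i‖ * ‖y‖ ≤ ‖S.a i‖ * |B| := by
      gcongr
      exact (hB y hy).trans (le_abs_self B)
    have := le_abs_self (S.b i)
    simp only [slack]
    linarith
  exact h1.trans (Finset.single_le_sum (f := fun i => |S.b i| + ‖S.a i‖ * |B|)
    (fun i _ => by positivity) (Finset.mem_univ i))

theorem sum_inner_sq_le_localNorm (S : LinSystem n) {x : EuclideanSpace ℝ (Fin n)} {D : ℝ}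
    (hx : ∀ i, 0 < S.slack x i) (hD : ∀ i, S.slack x i ≤ D) (v : EuclideanSpace ℝ (Fin n)) :
    ∑ i, inner ℝ (S.a i) v ^ 2 ≤ D ^ 2 * S.localNorm x v ^ 2 := by
  rw [localNorm, Real.sq_sqrt (Finset.sum_nonneg fun i _ => sq_nonneg _), Finset.mul_sum]
  refine Finset.sum_le_sum fun i _ => ?_
  have h1 := hx i
  calc inner ℝ (S.a i) v ^ 2
      = S.slack x i ^ 2 * (inner ℝ (S.a i) v / S.slack x i) ^ 2 := by field_simp
    _ ≤ D ^ 2 * (inner ℝ (S.a i) v / S.slack x i) ^ 2 := by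
      gcongr
      exact hD i

/-- Infinitely many cuts of bounded norm through approximate analytic centers cannot leave a point
all of whose slacks stay above a positive constant. -/
theorem not_forall_le_slack_of_cuts {T : ℕ → LinSystem n} {c x : ℕ → EuclideanSpace ℝ (Fin n)}
    (hη₁ : η < 1) (hT : ∀ k, T (k + 1) = (T k).addCut (c k) (inner ℝ (c k) (x k)))
    (hx : ∀ k, (T k).IsApproxCenter η (x k)) (hfull : (T 0).IsFullPolytope)
    {R : ℝ} (hc : ∀ k, ‖c k‖ ≤ R) {p : EuclideanSpace ℝ (Fin n)} {ε : ℝ} (hε : 0 < ε) :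
    ¬ ∀ k i, ε ≤ (T k).slack p i := by
  intro hp
  have hR : 0 ≤ R := (norm_nonneg _).trans (hc 0)
  have hsub : ∀ k, (T k).polyhedron ⊆ (T 0).polyhedron := by
    intro k
    induction k with
    | zero => exact subset_rfl
    | succ k ih =>
      rw [hT]
      exact fun y hy => ih (((T k).mem_polyhedron_addCut _ _ y).1 hy).1
  have hx0 : ∀ k, x k ∈ (T 0).polyhedron := fun k => hsub k (hx k).mem_polyhedron
  have hpos : ∀ k i, 0 < (T k).slack (x k) i := fun k => (hx k).slack_pos hη₁
  -- a common bound `D` for all slacks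
  obtain ⟨D, hD0, hD⟩ : ∃ D, 0 < D ∧ ∀ k, ∀ y ∈ (T 0).polyhedron, ∀ i, (T k).slack y i ≤ D := by
    obtain ⟨D₀, hD₀⟩ := (T 0).exists_slack_le hfull.bounded
    obtain ⟨B, hB⟩ := hfull.bounded.exists_norm_le
    have hBnn : 0 ≤ B := (norm_nonneg _).trans (hB _ (hx0 0))
    refine ⟨max (max D₀ (R * (B + B))) 1, by positivity, fun k => ?_⟩
    induction k with
    | zero => exact fun y hy i => (hD₀ y hy i).trans ((le_max_left _ _).trans (le_max_left _ _))
    | succ k ih =>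
      intro y hy
      rw [hT]
      refine ((T k).forall_addCut _ _ fun a b =>
        b - inner ℝ a y ≤ max (max D₀ (R * (B + B))) 1).2 ⟨ih y hy, ?_⟩
      refine le_trans ?_ ((le_max_right D₀ (R * (B + B))).trans (le_max_left _ _))
      rw [← inner_sub_right]
      refine (real_inner_le_norm _ _).trans ?_
      gcongr
      · exact hc k
      · exact (norm_sub_le _ _).trans (add_le_add (hB _ (hx0 k)) (hB _ hy))
  have hquad : ∀ k v, ∑ i, inner ℝ ((T k).a i) v ^ 2 =
      ∑ i, inner ℝ ((T 0).a i) v ^ 2 + ∑ l ∈ Finset.range k, inner ℝ (c l) v ^ 2 := by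
    intro k v
    induction k with
    | zero => simp
    | succ k ih =>
      rw [hT, Finset.sum_range_succ, ← add_assoc, ← ih]
      exact (T k).sum_addCut _ _ fun a _ => inner ℝ a v ^ 2
  have hm : ∀ k, (T k).m = (T 0).m + k := by
    intro k
    induction k with
    | zero => rfl
    | succ k ih => rw [hT]; simp only [addCut]; omega
  set α : ℝ := (1 - η) / 2 with hα
  have hαpos : 0 < α := by rw [hα]; linarith
  -- `K` comes from `log y ≤ y - 1` at `y = α (1 + t)`; it absorbs two copies of `log (1 + t)`, one
  -- from near-optimality and one from the cut slack.
  set K : ℝ := 2 * (α - 1 - Real.log α) with hK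
  have hlog : ∀ t : ℝ, 0 ≤ t → 2 * Real.log (1 + t) ≤ (1 - η) * t + K := by
    intro t ht
    have h1 := Real.log_le_sub_one_of_pos (x := α * (1 + t)) (by positivity)
    rw [Real.log_mul hαpos.ne' (by positivity)] at h1
    have h2 : (1 - η) * t = 2 * (α * t) := by rw [hα]; ring
    rw [h2, hK]
    linarith
  -- Chosen so that `log θ + K = log ε - 1`: each late cut loses 1 against the lower bound, which
  -- grows by `log ε`. Below, `δ = (θ / D) ^ 2` cancels the slack bound `D`.
  set θ : ℝ := Real.exp (Real.log ε - 1 - K) with hθ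
  have hθpos : 0 < θ := Real.exp_pos _
  have hQcont : Continuous fun v => ∑ i, inner ℝ ((T 0).a i) v ^ 2 := by fun_prop
  have hev := eventually_inner_sq_le_sum hQcont
    (fun r v => by simp only [inner_smul_right, mul_pow, Finset.mul_sum])
    (fun v hv => hfull.sum_inner_sq_pos hv) hc (δ := (θ / D) ^ 2) (by positivity)
  obtain ⟨N, hN⟩ := eventually_atTop.1 hev
  have hstep : ∀ k, N ≤ k →
      (T (k + 1)).logSlack (x (k + 1)) ≤ (T k).logSlack (x k) + (Real.log ε - 1) := by
    intro k hk
    have hnew := hpos (k + 1)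
    simp only [slack] at hnew
    rw [hT] at hnew
    obtain ⟨hold, hcut⟩ := ((T k).forall_addCut _ _ fun a b => 0 < b - inner ℝ a (x (k + 1))).1 hnew
    have h1 := (hx k).logSlack_le hη₁ hold
    set t := (T k).localNorm (x k) (x (k + 1) - x k) with ht
    have ht0 : 0 ≤ t := localNorm_nonneg _ _ _
    rw [← inner_sub_right] at hcut
    have h2 : inner ℝ (c k) (x k - x (k + 1)) ≤ θ * t := by
      refine le_of_sq_le_sq ?_ (by positivity)
      have h3 := hN k hk (x (k + 1) - x k)
      rw [← hquad] at h3
      have h4 := (T k).sum_inner_sq_le_localNorm (hpos k) (hD k (x k) (hx0 k)) (x (k + 1) - x k)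
      rw [← neg_sub (x (k + 1)), inner_neg_right, neg_sq]
      calc inner ℝ (c k) (x (k + 1) - x k) ^ 2 ≤ _ := h3
        _ ≤ (θ / D) ^ 2 * (D ^ 2 * t ^ 2) := by gcongr
        _ = (θ * t) ^ 2 := by field_simp
    have htpos : 0 < t := by
      by_contra! hle
      have : θ * t ≤ 0 := mul_nonpos_of_nonneg_of_nonpos hθpos.le hle
      linarith
    have h5 : Real.log (inner ℝ (c k) (x k - x (k + 1))) ≤ Real.log θ + Real.log (1 + t) := by
      rw [← Real.log_mul hθpos.ne' (by positivity)]
      refine Real.log_le_log hcut (h2.trans ?_)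
      gcongr
      linarith
    rw [hθ, Real.log_exp] at h5
    rw [hT, logSlack_addCut, ← inner_sub_right]
    linarith [hlog t ht0]
  have hlower : ∀ k, (T k).m * Real.log ε ≤ (T k).logSlack (x k) + K := by
    intro k
    have hpk : ∀ i, 0 < (T k).slack p i := fun i => hε.trans_le (hp k i)
    have h1 := (hx k).logSlack_le hη₁ hpk
    set t := (T k).localNorm (x k) (p - x k) with ht
    have ht0 : 0 ≤ t := localNorm_nonneg _ _ _
    have h2 : (T k).m * Real.log ε ≤ (T k).logSlack p := by
      have := Finset.card_nsmul_le_sum Finset.univ (fun i => Real.log ((T k).slack p i))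
        (Real.log ε) fun i _ => Real.log_le_log hε (hp k i)
      simpa [logSlack] using this
    have h3 : 0 ≤ Real.log (1 + t) := Real.log_nonneg (by linarith)
    linarith [hlog t ht0]
  have hupper : ∀ i : ℕ, (T (N + i)).logSlack (x (N + i)) ≤
      (T N).logSlack (x N) + i * (Real.log ε - 1) := by
    intro i
    induction i with
    | zero => simp
    | succ i ih =>
      have := hstep (N + i) (Nat.le_add_right _ _)
      rw [← add_assoc]
      push_cast
      linarith
  obtain ⟨i, hi⟩ := exists_nat_gt ((T N).logSlack (x N) + K - (T N).m * Real.log ε)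
  have h1 := hlower (N + i)
  have h2 := hupper i
  rw [hm (N + i), ← add_assoc, ← hm N] at h1
  push_cast at h1
  linarith

end LinSystem

/-! ### The gap function near and along solutions -/

section Gap

variable {n : ℕ} {F : EuclideanSpace ℝ (Fin n) → EuclideanSpace ℝ (Fin n)}
  {K : Set (EuclideanSpace ℝ (Fin n))}

theorem inner_sub_le_gap (hK : IsCompact K) (x : EuclideanSpace ℝ (Fin n))
    {y : EuclideanSpace ℝ (Fin n)} (hy : y ∈ K) : inner ℝ (F x) (x - y) ≤ gap F K x := by
  have hc : Continuous fun y => inner ℝ (F x) (x - y) := by fun_prop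
  exact le_csSup (hK.image hc).bddAbove ⟨y, hy, rfl⟩

theorem gap_eq_zero_of_eq_zero (hK : K.Nonempty) {x : EuclideanSpace ℝ (Fin n)} (hx : F x = 0) :
    gap F K x = 0 := by
  simp [gap, hx, hK.image_const]

theorem SolvesVI.eventually_gap_lt {x : EuclideanSpace ℝ (Fin n)} (hx : SolvesVI F K x)
    (hK : Bornology.IsBounded K) (hF : ContinuousOn F K) {g : ℝ} (hg : 0 < g) :
    ∀ᶠ w in 𝓝[K] x, gap F K w < g := by
  obtain ⟨B, hB⟩ := hK.exists_norm_le
  have hlim : Tendsto (fun w => inner ℝ (F x) (w - x) + ‖F w - F x‖ * (B + B)) (𝓝[K] x) (𝓝 0) := by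
    have h1 : Tendsto (fun w => F w - F x) (𝓝[K] x) (𝓝 0) := by
      simpa using (hF x hx.1).tendsto.sub_const (F x)
    have h2 : Tendsto (fun w => inner ℝ (F x) (w - x)) (𝓝[K] x) (𝓝 0) := by
      have hc : Continuous fun w => inner ℝ (F x) (w - x) := by fun_prop
      simpa using (hc.tendsto x).mono_left nhdsWithin_le_nhds
    simpa using h2.add (h1.norm.mul_const (B + B))
  filter_upwards [hlim.eventually_lt_const hg, self_mem_nhdsWithin] with w hw hwK
  refine lt_of_le_of_lt (csSup_le (Set.image_nonempty.2 ⟨x, hx.1⟩) ?_) hw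
  rintro _ ⟨y, hy, rfl⟩
  have h1 := hx.2 y hy
  have h2 : inner ℝ (F w - F x) (w - y) ≤ ‖F w - F x‖ * (B + B) := by
    refine (real_inner_le_norm _ _).trans ?_
    gcongr
    exact (norm_sub_le _ _).trans (add_le_add (hB _ hwK) (hB _ hy))
  rw [inner_sub_left] at h2
  have h3 : inner ℝ (F x) (w - y) = inner ℝ (F x) (w - x) - inner ℝ (F x) (y - x) := by
    rw [← inner_sub_right]; congr 1; abel
  change inner ℝ (F w) (w - y) ≤ _
  linarith

/-- The dual (Minty) form of a variational inequality with a strongly monotone map. -/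
theorem SolvesVI.le_inner_of_stronglyMonotone {x : EuclideanSpace ℝ (Fin n)} (hx : SolvesVI F K x)
    {M : ℝ} (hM : ∀ x ∈ K, ∀ y ∈ K, M * ‖y - x‖ ^ 2 ≤ inner ℝ (F y - F x) (y - x))
    {w : EuclideanSpace ℝ (Fin n)} (hw : w ∈ K) : M * ‖w - x‖ ^ 2 ≤ inner ℝ (F w) (w - x) := by
  have h1 := hM x hx.1 w hw
  have h2 := hx.2 w hw
  rw [inner_sub_left] at h1
  linarith

theorem SolvesVI.tendsto_of_gap_lt {X : Set (EuclideanSpace ℝ (Fin n))}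
    {C : ℕ → Set (EuclideanSpace ℝ (Fin n))} {xstar : EuclideanSpace ℝ (Fin n)}
    (hxstar : SolvesVI F X xstar) (hF : ContinuousOn F X) (hmono : StronglyMonotoneOn F X)
    (hC : ∀ j, 1 ≤ j → IsCompact (C j)) (hCmono : ∀ j, 1 ≤ j → C j ⊆ C (j + 1))
    (hCX : closure (⋃ j ∈ Set.Ici 1, C j) = X)
    {J : ℕ → ℕ} {x : ℕ → EuclideanSpace ℝ (Fin n)} (hJ : Tendsto J atTop atTop)
    (hx : ∀ i, x i ∈ C (J i)) (hgap : ∀ i, gap F (C (J i)) (x i) < 1 / 2 ^ J i) :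
    Tendsto x atTop (𝓝 xstar) := by
  obtain ⟨M, hM, hmono⟩ := hmono
  have hsub : ∀ j, 1 ≤ j → C j ⊆ X := fun j hj =>
    hCX ▸ (Set.subset_biUnion_of_mem (u := C) (Set.mem_Ici.2 hj)).trans subset_closure
  rw [Metric.tendsto_nhds]
  intro δ hδ
  -- `xstar` may lie in no `C j`, so the gap bound is used at a nearby `y` in the union. The
  -- thresholds give `M r² < M δ² / 8 + (M δ / 4) r` for `r = ‖x i - y‖`, which forces `r < δ / 2`.
  obtain ⟨y, ⟨⟨hy1, hy2⟩, hy3⟩, hyU⟩ : ∃ y, ((‖y - xstar‖ < δ / 2 ∧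
      ‖F y - F xstar‖ < M * δ / 4) ∧ ‖F xstar‖ * ‖y - xstar‖ < M * δ ^ 2 / 16) ∧
      y ∈ ⋃ j ∈ Set.Ici 1, C j := by
    have hmem : xstar ∈ closure (⋃ j ∈ Set.Ici 1, C j) := hCX ▸ hxstar.1
    have := mem_closure_iff_nhdsWithin_neBot.1 hmem
    have hUX : (⋃ j ∈ Set.Ici 1, C j) ⊆ X := hCX ▸ subset_closure
    have h1 : Tendsto (fun y => ‖y - xstar‖) (𝓝[⋃ j ∈ Set.Ici 1, C j] xstar) (𝓝 0) := by
      have hc : Continuous fun y => ‖y - xstar‖ := by fun_prop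
      simpa using (hc.tendsto xstar).mono_left nhdsWithin_le_nhds
    have h2 : Tendsto (fun y => ‖F y - F xstar‖) (𝓝[⋃ j ∈ Set.Ici 1, C j] xstar) (𝓝 0) := by
      simpa using (((hF xstar hxstar.1).mono hUX).tendsto.sub_const (F xstar)).norm
    have h3 : Tendsto (fun y => ‖F xstar‖ * ‖y - xstar‖)
        (𝓝[⋃ j ∈ Set.Ici 1, C j] xstar) (𝓝 0) := by
      simpa using h1.const_mul ‖F xstar‖
    exact (((h1.eventually_lt_const (by positivity)).and
      (h2.eventually_lt_const (by positivity))).and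
      ((h3.eventually_lt_const (by positivity)))).and self_mem_nhdsWithin |>.exists
  obtain ⟨j₀, hj₀, hyj⟩ : ∃ j₀, 1 ≤ j₀ ∧ y ∈ C j₀ := by simpa using hyU
  have hymem : ∀ j, j₀ ≤ j → y ∈ C j := by
    intro j hj
    induction j, hj using Nat.le_induction with
    | base => exact hyj
    | succ j hj ih => exact hCmono j (hj₀.trans hj) ih
  have hpow : Tendsto (fun i => (1 : ℝ) / 2 ^ J i) atTop (𝓝 0) := by
    have h1 := (tendsto_pow_atTop_nhds_zero_of_lt_one (r := (1 / 2 : ℝ)) (by norm_num)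
      (by norm_num)).comp hJ
    refine h1.congr fun i => ?_
    simp
  filter_upwards [hJ.eventually_ge_atTop j₀,
    hpow.eventually_lt_const (show 0 < M * δ ^ 2 / 16 by positivity)] with i hi hpi
  have hJ1 := hj₀.trans hi
  have hxX := hsub _ hJ1 (hx i)
  have hyX := hsub _ hj₀ hyj
  have h1 := hmono y hyX (x i) hxX
  have h2 : inner ℝ (F (x i)) (x i - y) < M * δ ^ 2 / 16 :=
    (inner_sub_le_gap (hC _ hJ1) (x i) (hymem _ hi)).trans_lt ((hgap i).trans hpi)
  have h3 := hxstar.2 (x i) hxX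
  have h4 : -(‖F y - F xstar‖ * ‖x i - y‖) ≤ inner ℝ (F y - F xstar) (x i - y) :=
    (abs_le.1 (abs_real_inner_le_norm _ _)).1
  have h5 := real_inner_le_norm (F xstar) (y - xstar)
  have h6 : inner ℝ (F xstar) (x i - y) =
      inner ℝ (F xstar) (x i - xstar) - inner ℝ (F xstar) (y - xstar) := by
    rw [← inner_sub_right]; congr 1; abel
  rw [inner_sub_left] at h1 h4
  have h7 : ‖F y - F xstar‖ * ‖x i - y‖ ≤ M * δ / 4 * ‖x i - y‖ := by gcongr
  have h8 : M * ‖x i - y‖ ^ 2 < M * δ ^ 2 / 8 + M * δ / 4 * ‖x i - y‖ := by linarith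
  have h9 : ‖x i - y‖ < δ / 2 := by
    by_contra! hge
    have h10 : M * (δ / 2) * ‖x i - y‖ ≤ M * ‖x i - y‖ * ‖x i - y‖ := by gcongr
    have h11 : M * (δ / 2) * (δ / 2) ≤ M * (δ / 2) * ‖x i - y‖ := by gcongr
    nlinarith
  calc dist (x i) xstar ≤ dist (x i) y + dist y xstar := dist_triangle _ _ _
    _ = ‖x i - y‖ + ‖y - xstar‖ := by rw [dist_eq_norm, dist_eq_norm]
    _ < δ := by linarith

end Gap

/-! ### Finiteness of the cuts within one stage -/

namespace LinSystem

variable {n : ℕ} {F : EuclideanSpace ℝ (Fin n) → EuclideanSpace ℝ (Fin n)} {S : LinSystem n}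
  {η : ℝ}

theorem IsFullPolytope.isCompact (h : S.IsFullPolytope) : IsCompact S.polyhedron :=
  Metric.isCompact_of_isClosed_isBounded S.isClosed_polyhedron h.bounded

theorem IsFullPolytope.nonempty (h : S.IsFullPolytope) : S.polyhedron.Nonempty := by
  obtain ⟨q, hq⟩ := h.strict
  exact ⟨q, fun i => (hq i).le⟩

/-- A nonzero cut through an approximate analytic center leaves a full polytope. -/
theorem IsFullPolytope.addCut (h : S.IsFullPolytope) {x c : EuclideanSpace ℝ (Fin n)}
    (hx : S.IsApproxCenter η x) (hη₁ : η < 1) (hc : c ≠ 0) :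
    (S.addCut c (inner ℝ c x)).IsFullPolytope := by
  refine ⟨h.bounded.subset fun y hy => ((S.mem_polyhedron_addCut _ _ y).1 hy).1, ?_⟩
  have hev : ∀ᶠ r : ℝ in 𝓝[>] 0, ∀ i, 0 < S.slack (x - r • c) i := by
    refine nhdsWithin_le_nhds (eventually_all.2 fun i => ?_)
    have hcont : Continuous fun r : ℝ => S.slack (x - r • c) i :=
      (S.continuous_slack i).comp (by fun_prop)
    exact hcont.continuousAt.eventually_mem (Ioi_mem_nhds (by simpa using hx.slack_pos hη₁ i))
  obtain ⟨r, hr, hr0⟩ := (hev.and self_mem_nhdsWithin).exists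
  refine ⟨x - r • c, (S.forall_addCut _ _ fun a b => inner ℝ a (x - r • c) < b).2
    ⟨fun i => sub_pos.1 (hr i), ?_⟩⟩
  rw [inner_sub_right, inner_smul_right, sub_lt_self_iff, real_inner_self_eq_norm_sq]
  have := norm_pos_iff.2 hc
  have : 0 < r := hr0
  positivity

/-- Cutting a polytope repeatedly at approximate analytic centers makes the gap small. -/
theorem exists_gap_lt_of_cuts (hη₁ : η < 1) (hS : S.IsFullPolytope)
    (hF : ContinuousOn F S.polyhedron) (hmono : StronglyMonotoneOn F S.polyhedron)
    {T : ℕ → LinSystem n} {x : ℕ → EuclideanSpace ℝ (Fin n)}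
    (hT : ∀ k, T (k + 1) = (T k).addCut (F (x k)) (inner ℝ (F (x k)) (x k)))
    (hx : ∀ k, (T k).IsApproxCenter η (x k)) (hfull : (T 0).IsFullPolytope)
    (hxS : ∀ k, x k ∈ S.polyhedron)
    (hsol : ∀ y, SolvesVI F S.polyhedron y → y ∈ (T 0).polyhedron) {g : ℝ} (hg : 0 < g) :
    ∃ k, gap F S.polyhedron (x k) < g := by
  by_contra! hgap
  obtain ⟨u, hu⟩ := exists_solvesVI_of_isCompact S.convex_polyhedron hS.isCompact hS.nonempty hF
    hmono.inner_nonneg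
  obtain ⟨M, hM, hmono⟩ := hmono
  obtain ⟨R, hR⟩ := (hS.isCompact.image_of_continuousOn hF).isBounded.exists_norm_le
  have hFR : ∀ k, ‖F (x k)‖ ≤ R := fun k => hR _ ⟨_, hxS k, rfl⟩
  have hR0 : 0 ≤ R := (norm_nonneg _).trans (hFR 0)
  obtain ⟨ρ, hρ, hball⟩ := Metric.mem_nhdsWithin_iff.1 (hu.eventually_gap_lt hS.bounded hF hg)
  have hfar : ∀ k, ρ ≤ ‖x k - u‖ := by
    intro k
    by_contra! hlt
    exact absurd (hball ⟨by rwa [Metric.mem_ball, dist_eq_norm], hxS k⟩) (not_lt.2 (hgap k))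
  obtain ⟨q, hq⟩ := hfull.strict
  have hu0 := hsol u hu
  obtain ⟨e, he, he0⟩ : ∃ e, (∀ i, e ≤ (T 0).slack q i) ∧ e ∈ Set.Ioi (0 : ℝ) := by
    have hev : ∀ᶠ e in 𝓝[>] (0 : ℝ), ∀ i, e ≤ (T 0).slack q i :=
      nhdsWithin_le_nhds (eventually_all.2 fun i => eventually_le_nhds (sub_pos.2 (hq i)))
    exact (hev.and self_mem_nhdsWithin).exists
  have he0 : 0 < e := he0
  -- `u` may lie on the boundary, hence the shift towards `q`. Its size costs each cut at most half
  -- of the slack `M * ρ ^ 2` at `u`; the `+ 1` avoids a zero denominator.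
  set s : ℝ := min 1 (M * ρ ^ 2 / (2 * (R * ‖q - u‖ + 1))) with hs
  have hspos : 0 < s := by positivity
  have hs1 : s ≤ 1 := min_le_left _ _
  have hsR : s * (R * ‖q - u‖) ≤ M * ρ ^ 2 / 2 := by
    have h1 : s ≤ M * ρ ^ 2 / (2 * (R * ‖q - u‖ + 1)) := min_le_right _ _
    rw [le_div_iff₀ (by positivity)] at h1
    linarith
  refine not_forall_le_slack_of_cuts hη₁ hT hx hfull hFR (p := u + s • (q - u))
    (ε := min (s * e) (M * ρ ^ 2 / 2)) (by positivity) fun k => ?_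
  induction k with
  | zero =>
    intro i
    refine (min_le_left _ _).trans ?_
    have h1 : (T 0).slack (u + s • (q - u)) i =
        (1 - s) * (T 0).slack u i + s * (T 0).slack q i := by
      simp only [slack, inner_add_right, inner_smul_right, inner_sub_right]; ring
    have h2 := mul_nonneg (sub_nonneg.2 hs1) (((T 0).mem_polyhedron_iff_slack u).1 hu0 i)
    have h3 := mul_le_mul_of_nonneg_left (he i) hspos.le
    linarith
  | succ k ih =>
    rw [hT]
    refine ((T k).forall_addCut _ _ fun a b =>
      min (s * e) (M * ρ ^ 2 / 2) ≤ b - inner ℝ a (u + s • (q - u))).2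
      ⟨ih, (min_le_right _ _).trans ?_⟩
    rw [← inner_sub_right, ← sub_sub, inner_sub_right, inner_smul_right]
    have h1 := hu.le_inner_of_stronglyMonotone hmono (hxS k)
    have h2 : M * ρ ^ 2 ≤ M * ‖x k - u‖ ^ 2 := by
      gcongr
      exact hfar k
    have h3 : s * inner ℝ (F (x k)) (q - u) ≤ s * (R * ‖q - u‖) := by
      gcongr
      refine (real_inner_le_norm _ _).trans ?_
      gcongr
      exact hFR k
    linarith

end LinSystem

/-! ### Runs of the algorithm -/

/-- The invariant of the cutting plane algorithm. -/
structure CutState.Valid {n : ℕ} (F : EuclideanSpace ℝ (Fin n) → EuclideanSpace ℝ (Fin n))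
    (S : ℕ → LinSystem n) (η : ℝ) (s : CutState n) : Prop where
  one_le : 1 ≤ s.j
  full : s.sys.IsFullPolytope
  subset : s.sys.polyhedron ⊆ (S s.j).polyhedron
  center : s.sys.IsApproxCenter η s.x
  sol : ∀ y, SolvesVI F (S s.j).polyhedron y → y ∈ s.sys.polyhedron

section Algorithm

variable {n : ℕ} {F : EuclideanSpace ℝ (Fin n) → EuclideanSpace ℝ (Fin n)}
  {S : ℕ → LinSystem n} {η : ℝ} {s s' : CutState n}

theorem CutState.Valid.mem (h : s.Valid F S η) : s.x ∈ (S s.j).polyhedron :=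
  h.subset h.center.mem_polyhedron

/-- Only a zero cut could destroy strict feasibility, but `F s.x = 0` makes the gap 0, and then no
cut is made. -/
theorem CutState.Valid.full_addCut (h : s.Valid F S η)
    (hS : ∀ j, 1 ≤ j → (S j).IsFullPolytope) (hη₁ : η < 1)
    (hgap : ¬ gap F (S s.j).polyhedron s.x < 1 / 2 ^ s.j) :
    (s.sys.addCut (F s.x) (inner ℝ (F s.x) s.x)).IsFullPolytope := by
  refine h.full.addCut h.center hη₁ fun h0 => hgap ?_
  rw [gap_eq_zero_of_eq_zero (hS _ h.one_le).nonempty h0]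
  positivity

theorem IsInitialState.valid (h : IsInitialState S η s)
    (hS : ∀ j, 1 ≤ j → (S j).IsFullPolytope) : s.Valid F S η := by
  obtain ⟨hj, -, hsys, hx⟩ := h
  exact ⟨hj.ge, hsys ▸ hS 1 le_rfl, by rw [hj, hsys], hx, fun y hy => by
    rw [hsys]; rw [hj] at hy; exact hy.1⟩

/-- The solution on `C_j` survives each cut by the Minty inequality `0 ≤ F(x)ᵀ (x - y)`. -/
theorem CutStep.valid (h : CutStep F S η s s') (hs : s.Valid F S η)
    (hS : ∀ j, 1 ≤ j → (S j).IsFullPolytope) (hη₁ : η < 1)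
    (hmono : ∀ j, 1 ≤ j → StronglyMonotoneOn F (S j).polyhedron) : s'.Valid F S η := by
  obtain ⟨⟨-, hj, -, hsys⟩ | ⟨hgap, hj, -, hsys⟩, hx⟩ := h
  · refine ⟨hj ▸ Nat.le_add_left _ _, hsys ▸ hS _ (Nat.le_add_left _ _), by rw [hj, hsys], hx,
      fun y hy => ?_⟩
    rw [hsys]; rw [hj] at hy; exact hy.1
  · refine ⟨hj ▸ hs.one_le, hsys ▸ hs.full_addCut hS hη₁ hgap, ?_, hx, fun y hy => ?_⟩
    · rw [hj, hsys]
      exact fun y hy => hs.subset ((s.sys.mem_polyhedron_addCut _ _ y).1 hy).1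
    · rw [hj] at hy
      rw [hsys]
      refine (s.sys.mem_polyhedron_addCut _ _ y).2 ⟨hs.sol y hy, ?_⟩
      obtain ⟨M, hM, hF⟩ := hmono _ hs.one_le
      have h1 := hy.le_inner_of_stronglyMonotone hF hs.mem
      have h2 : 0 ≤ M * ‖s.x - y‖ ^ 2 := by positivity
      rw [inner_sub_right] at h1
      linarith

/-- The next system is a full polytope in either branch, so it has a center. Thus no valid run gets
stuck. -/
theorem CutState.Valid.exists_cutStep (h : s.Valid F S η)
    (hS : ∀ j, 1 ≤ j → (S j).IsFullPolytope) (hη₀ : 0 ≤ η) (hη₁ : η < 1) :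
    ∃ s', CutStep F S η s s' := by
  by_cases hgap : gap F (S s.j).polyhedron s.x < 1 / 2 ^ s.j
  · obtain ⟨x, hx⟩ := (hS (s.j + 1) (Nat.le_add_left _ _)).exists_isApproxCenter hη₀
    exact ⟨⟨s.j + 1, 0, S (s.j + 1), x⟩, Or.inl ⟨hgap, rfl, rfl, rfl⟩, hx⟩
  · obtain ⟨x, hx⟩ := (h.full_addCut hS hη₁ hgap).exists_isApproxCenter hη₀
    exact ⟨⟨s.j, s.k + 1, _, x⟩, Or.inr ⟨hgap, rfl, rfl, rfl⟩, hx⟩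

theorem CutStep.j_le (h : CutStep F S η s s') : s.j ≤ s'.j := by
  obtain ⟨⟨-, hj, -, -⟩ | ⟨-, hj, -, -⟩, -⟩ := h <;> omega

theorem CutStep.j_lt_of_gap_lt (h : CutStep F S η s s')
    (hgap : gap F (S s.j).polyhedron s.x < 1 / 2 ^ s.j) : s.j < s'.j := by
  obtain ⟨⟨-, hj, -, -⟩ | ⟨hn, -⟩, -⟩ := h
  · omega
  · exact absurd hgap hn

/-- In an infinite run, the gap falls below the threshold infinitely often. -/
theorem frequently_gap_lt {σ : ℕ → CutState n} (hstep : ∀ t, CutStep F S η (σ t) (σ (t + 1)))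
    (hvalid : ∀ t, (σ t).Valid F S η) (hS : ∀ j, 1 ≤ j → (S j).IsFullPolytope) (hη₁ : η < 1)
    (hF : ∀ j, 1 ≤ j → ContinuousOn F (S j).polyhedron)
    (hmono : ∀ j, 1 ≤ j → StronglyMonotoneOn F (S j).polyhedron) :
    ∃ᶠ t in atTop, gap F (S (σ t).j).polyhedron (σ t).x < 1 / 2 ^ (σ t).j := by
  rw [frequently_atTop]
  intro t₀
  by_contra! hno
  have hno' : ∀ k, ¬ gap F (S (σ (t₀ + k)).j).polyhedron (σ (t₀ + k)).x <
      1 / 2 ^ (σ (t₀ + k)).j := fun k => not_lt.2 (hno _ (Nat.le_add_right _ _))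
  -- From `t₀` on every step is a cut, so the stage is fixed. The system at `t₀` may already contain
  -- cuts, which is why the invariant records that they keep the solution.
  have hcut : ∀ k, (σ (t₀ + (k + 1))).j = (σ (t₀ + k)).j ∧ (σ (t₀ + (k + 1))).sys =
      (σ (t₀ + k)).sys.addCut (F (σ (t₀ + k)).x) (inner ℝ (F (σ (t₀ + k)).x) (σ (t₀ + k)).x) := by
    intro k
    obtain ⟨⟨h, -⟩ | ⟨-, hj, -, hsys⟩, -⟩ := hstep (t₀ + k)
    · exact absurd h (hno' k)
    · exact ⟨hj, hsys⟩
  have hj : ∀ k, (σ (t₀ + k)).j = (σ t₀).j := by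
    intro k
    induction k with
    | zero => rfl
    | succ k ih => rw [(hcut k).1, ih]
  have h1 := (hvalid t₀).one_le
  obtain ⟨k, hk⟩ := LinSystem.exists_gap_lt_of_cuts (T := fun k => (σ (t₀ + k)).sys)
    (x := fun k => (σ (t₀ + k)).x) hη₁ (hS _ h1) (hF _ h1) (hmono _ h1) (fun k => (hcut k).2)
    (fun k => (hvalid _).center) (hvalid t₀).full (fun k => hj k ▸ (hvalid (t₀ + k)).mem)
    (hvalid t₀).sol (g := 1 / 2 ^ (σ t₀).j) (by positivity)
  refine hno' k ?_
  rw [hj]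
  exact hk

end Algorithm

end

theorem theorem6 (n : ℕ)
    (F : EuclideanSpace ℝ (Fin n) → EuclideanSpace ℝ (Fin n))
    (X : Set (EuclideanSpace ℝ (Fin n)))
    (hXconvex : Convex ℝ X) (hXclosed : IsClosed X) (hXint : (interior X).Nonempty)
    (hFcont : ContinuousOn F X) (hFmono : StronglyMonotoneOn F X)
    (S : ℕ → LinSystem n)
    (hS : ∀ j, 1 ≤ j → (S j).IsFullPolytope)
    (hSmono : ∀ j, 1 ≤ j → (S j).polyhedron ⊆ (S (j + 1)).polyhedron)
    (hSX : closure (⋃ j ∈ Set.Ici 1, (S j).polyhedron) = X)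
    (η : ℝ) (hη₀ : 0 ≤ η) (hη₁ : η < 1) :
    ∃ xstar : EuclideanSpace ℝ (Fin n),
      -- `xstar` is the unique solution of `VI(F, X)`
      (SolvesVI F X xstar ∧ ∀ y, SolvesVI F X y → y = xstar) ∧
      -- the algorithm can be started
      (∃ s, IsInitialState S η s) ∧
      -- every complete run stops at the solution, or is infinite and subconverges to it
      ∀ (N : ℕ∞) (σ : ℕ → CutState n), IsCompleteRun F X S η N σ →
        (∃ T : ℕ, N = ((T + 1 : ℕ) : ℕ∞) ∧ (σ T).x = xstar) ∨
        (N = ⊤ ∧ ∃ φ : ℕ → ℕ, StrictMono φ ∧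
          Tendsto (fun i => (σ (φ i)).x) atTop (𝓝 xstar)) := by
  have hne : X.Nonempty := hXint.mono interior_subset
  have hsub : ∀ j, 1 ≤ j → (S j).polyhedron ⊆ X := fun j hj =>
    hSX ▸ (Set.subset_biUnion_of_mem (u := fun j => (S j).polyhedron)
      (Set.mem_Ici.2 hj)).trans subset_closure
  have hF : ∀ j, 1 ≤ j → ContinuousOn F (S j).polyhedron := fun j hj => hFcont.mono (hsub j hj)
  have hmono : ∀ j, 1 ≤ j → StronglyMonotoneOn F (S j).polyhedron :=
    fun j hj => hFmono.mono (hsub j hj)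
  obtain ⟨xstar, hxstar⟩ := hFmono.exists_solvesVI hXconvex hXclosed hne hFcont
  refine ⟨xstar, ⟨hxstar, fun y hy => hFmono.solvesVI_unique hxstar hy⟩, ?_, ?_⟩
  · obtain ⟨x, hx⟩ := (hS 1 le_rfl).exists_isApproxCenter hη₀
    exact ⟨⟨1, 0, S 1, x⟩, rfl, rfl, rfl, hx⟩
  intro N σ hrun
  have hvalid : ∀ t : ℕ, (t : ℕ∞) < N → (σ t).Valid F S η := by
    intro t
    induction t with
    | zero => exact fun _ => hrun.init.valid hS
    | succ t ih =>
      intro ht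
      refine (hrun.step t ht).valid (ih (lt_of_le_of_lt ?_ ht)) hS hη₁ hmono
      exact_mod_cast Nat.le_succ t
  by_cases hN : N = ⊤
  · right
    subst hN
    have hstep : ∀ t, CutStep F S η (σ t) (σ (t + 1)) :=
      fun t => hrun.step t (ENat.natCast_lt_top _)
    have hvalid : ∀ t, (σ t).Valid F S η := fun t => hvalid t (ENat.natCast_lt_top _)
    obtain ⟨φ, hφ, hgap⟩ := extraction_of_frequently_atTop
      (frequently_gap_lt hstep hvalid hS hη₁ hF hmono)
    refine ⟨rfl, φ, hφ, ?_⟩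
    have hjmono : Monotone fun t => (σ t).j := monotone_nat_of_le_succ fun t => (hstep t).j_le
    -- Each selected iterate triggers an increase of `j`, and `φ i + 1 ≤ φ (i + 1)`.
    have hJ : StrictMono fun i => (σ (φ i)).j := strictMono_nat_of_lt_succ fun i =>
      ((hstep (φ i)).j_lt_of_gap_lt (hgap i)).trans_le (hjmono (hφ (Nat.lt_succ_self i)))
    exact hxstar.tendsto_of_gap_lt hFcont hFmono (C := fun j => (S j).polyhedron)
      (fun j hj => (hS j hj).isCompact) hSmono hSX hJ.tendsto_atTop
      (fun i => (hvalid (φ i)).mem) hgap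
  · left
    obtain ⟨m, rfl⟩ := ENat.ne_top_iff_exists.1 hN
    obtain ⟨T, rfl⟩ : ∃ T, m = T + 1 := by
      have : 1 ≤ m := by exact_mod_cast hrun.pos
      exact ⟨m - 1, by omega⟩
    refine ⟨T, rfl, ?_⟩
    rcases hrun.complete T rfl with hT | hT
    · exact hFmono.solvesVI_unique hxstar hT
    · have : (T : ℕ∞) < ((T + 1 : ℕ) : ℕ∞) := by exact_mod_cast Nat.lt_succ_self T
      exact absurd ((hvalid T this).exists_cutStep hS hη₀ hη₁) hT
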